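/- For a set $P\subseteq\mathbb R^n$ let the extension complexity $\mathrm{xc}(P)$ be the smallest number $k$ such that $P$ is the image, under a linear map $\mathbb R^m\to\mathbb R^n$ for some $m$, of a polyhedron $\{z\in\mathbb R^m : Cz\le c,\ Dz=d\}$ whose description (with arbitrary real coefficients) has exactly $k$ inequalities and any number of equations. For $\varepsilon>0$ let $P+\varepsilon=\{x+z : x\in P,\ \|z\|_2\le\varepsilon\}$, and for $Q\subseteq\mathbb R^n\times\mathbb R^r$ let $\mathrm{proj}_x(Q)=\{x : \exists y,\ (x,y)\in Q\}$. The encoding length of a rational $p/q$ in lowest terms ($q>0$) is $1+\lceil\log_2(|p|+1)\rceil+\lceil\log_2(q+1)\rceil$; that of a rational vector or matrix is the number of its entries plus the sum of their encoding lengths. **Theorem.** There is a polynomial $p$ in three variables such that the following holds for every $n\ge 0$, every nonempty $X\subseteq\{0,1\}^n$ and every real $\varepsilon>0$. Let $P=\mathrm{conv}(X)$ and $r=\mathrm{xc}(P)$. There are $B\in\mathbb Q^{(4r+2n)\times n}$, $C\in\mathbb Q^{(4r+2n)\times r}$ and $d\in\mathbb Q^{4r+2n}$ of total encoding length at most $p\big(n,\,r,\,\max\{0,\log(1/\varepsilon)\}\big)$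 such that $$Q=\{(x,y)\in\mathbb R^n\times\mathbb R^r : Bx+Cy\le d\}$$ is bounded (so $Q$ is a polytope) and $$P\subseteq\mathrm{proj}_x(Q)\subseteq P+\varepsilon .$$ Furthermore, for every $c\in\mathbb R^n$, the linear function $x\mapsto c^Tx$ attains its maximum on both $\mathrm{proj}_x(Q)$ and $P$, and $$\max\{c^Tx : x\in\mathrm{proj}_x(Q)\}-\max\{c^Tx : x\in P\}\le\varepsilon\,\|c\|_2 .$$ -/

import Mathlib

/-- An extended formulation of size `k` of a set `P` in `ℝⁿ`: a polyhedron in some `ℝᵐ`, described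
by `k` linear inequalities `C z ≤ c` and any number of linear equations `D z = d`, together with a
linear map onto `P`. All coefficients may be arbitrary real numbers. -/
def HasExtendedFormulation {n : ℕ} (P : Set (EuclideanSpace ℝ (Fin n))) (k : ℕ) : Prop :=
  ∃ (m q : ℕ) (p : (Fin m → ℝ) →ₗ[ℝ] EuclideanSpace ℝ (Fin n))
    (C : Matrix (Fin k) (Fin m) ℝ) (c : Fin k → ℝ)
    (D : Matrix (Fin q) (Fin m) ℝ) (d : Fin q → ℝ),
    p '' {z | (∀ i, C.mulVec z i ≤ c i) ∧ D.mulVec z = d} = P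

/-- The convex hull of a finite set has an extended formulation, so that the infimum in the
definition of the extension complexity below is a minimum. -/
theorem exists_hasExtendedFormulation {n : ℕ} {X : Set (EuclideanSpace ℝ (Fin n))}
    (hX : X.Finite) : ∃ k, HasExtendedFormulation (convexHull ℝ X) k := by
  classical
  obtain ⟨v, f, rfl⟩ : ∃ (v : ℕ) (f : Fin v → EuclideanSpace ℝ (Fin n)), Set.range f = X := by
    have := hX.to_subtype
    obtain ⟨v, ⟨e⟩⟩ := Finite.exists_equiv_fin X
    exact ⟨v, fun i => (e.symm i : EuclideanSpace ℝ (Fin n)), by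
      rw [Set.range_comp' Subtype.val e.symm, e.symm.surjective.range_eq]; simp⟩
  refine ⟨v, v, 1, Fintype.linearCombination ℝ f, -1, 0, fun _ _ => 1, fun _ => 1, ?_⟩
  have h1 : {z : Fin v → ℝ | (∀ i, (-1 : Matrix (Fin v) (Fin v) ℝ).mulVec z i ≤ (0 : Fin v → ℝ) i) ∧
      Matrix.mulVec (fun (_ : Fin 1) (_ : Fin v) => (1 : ℝ)) z = fun _ => 1} = stdSimplex ℝ (Fin v) := by
    ext z
    simp [stdSimplex, funext_iff, Matrix.mulVec, dotProduct, Matrix.one_apply]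
  rw [h1, ← convexHull_basis_eq_stdSimplex, LinearMap.image_convexHull, ← Set.range_comp]
  congr 2
  ext1 i
  simp [Fintype.linearCombination_apply]

/-- The extension complexity of `P`: the smallest size of an extended formulation of `P`. -/
noncomputable def xc {n : ℕ} (P : Set (EuclideanSpace ℝ (Fin n))) : ℕ :=
  sInf {k | HasExtendedFormulation P k}

/-- The polyhedron `{(x, y) ∈ ℝⁿ × ℝʳ : B x + C y ≤ d}` given by `m` rational inequalities. -/
def ratPolyhedron {m n r : ℕ} (B : Matrix (Fin m) (Fin n) ℚ) (C : Matrix (Fin m) (Fin r) ℚ)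
    (d : Fin m → ℚ) : Set (EuclideanSpace ℝ (Fin n) × EuclideanSpace ℝ (Fin r)) :=
  {z | ∀ i, ∑ j, (B i j : ℝ) * z.1 j + ∑ j, (C i j : ℝ) * z.2 j ≤ (d i : ℝ)}

/-- The projection on the `x`-variables. -/
def projX {n r : ℕ} (Q : Set (EuclideanSpace ℝ (Fin n) × EuclideanSpace ℝ (Fin r))) :
    Set (EuclideanSpace ℝ (Fin n)) :=
  {x | ∃ y, (x, y) ∈ Q}

/-- The Euclidean neighbourhood `P + ε = {x + z : x ∈ P, ‖z‖₂ ≤ ε}`. -/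
def fatten {n : ℕ} (P : Set (EuclideanSpace ℝ (Fin n))) (ε : ℝ) :
    Set (EuclideanSpace ℝ (Fin n)) :=
  {w | ∃ x ∈ P, ∃ z, ‖z‖ ≤ ε ∧ w = x + z}

/-- Encoding length of a rational number `p / q` in lowest terms: one sign bit and the binary
digits of `|p|` and of `q`, that is, `1 + ⌈log₂ (|p| + 1)⌉ + ⌈log₂ (q + 1)⌉`. -/
def ratLength (a : ℚ) : ℕ := 1 + a.num.natAbs.size + a.den.size

/-- Encoding length of a rational vector: its number of entries plus the lengths of the entries. -/
def vecLength {m : ℕ} (d : Fin m → ℚ) : ℕ := m + ∑ i, ratLength (d i)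

/-- Encoding length of a rational matrix: its number of entries plus the lengths of the entries. -/
def matLength {m n : ℕ} (B : Matrix (Fin m) (Fin n) ℚ) : ℕ :=
  m * n + ∑ i, ∑ j, ratLength (B i j)

/-! Lift each `x` in `X` to the point `(x, y)`, where `y` lists the `r` slacks of a preimage of `x`,
each scaled to have maximum 1 over `X` or to vanish. Let `Z` be the set of lifts. A point of its
affine span with `y ≥ 0` projects into `P`, so only that span needs rational data. It is the set `M
(z - z₀) = 0`, with `M` the orthogonal projection along its direction, whose entries lie in `[-1,
1]`. Round `2 ^ T` times these `n + r` equations to integers and relax each to a two-sided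
inequality with tolerance `n + r + 1`. With the box `0 ≤ y ≤ 1` this makes `2 (n + r) + 2 r = 4 r +
2 n` inequalities.

Rounding errors at points of `Z` stay within the tolerance, so `Q` projects onto a superset of `P`.
Conversely, `z - M (z - z₀)` lies in the affine span and is near any feasible `z`; its slightly
negative slacks are repaired by averaging with points of `Z` having slack 1
(`exists_mem_near_of_near_affineSpan`). The result projects into `P`. -/

/-! ### Encoding length -/

/-- Clearing denominators `2 ^ T` bounds the encoding length. -/
theorem ratLength_intCast_div_two_pow_le {a : ℤ} {T s : ℕ} (ha : a.natAbs < 2 ^ (T + s)) :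
    ratLength ((a : ℚ) / 2 ^ T) ≤ 2 * T + s + 2 := by
  have hN : ((a : ℚ) / 2 ^ T) = (a : ℚ) / ((2 ^ T : ℤ) : ℚ) := by push_cast; rfl
  have hnum : ((a : ℚ) / 2 ^ T).num.natAbs ≤ a.natAbs := by
    rcases eq_or_ne a 0 with rfl | h0
    · simp
    · rw [hN, ← Rat.divInt_eq_div]
      exact Nat.le_of_dvd (Int.natAbs_pos.2 h0)
        (Int.natAbs_dvd_natAbs.2 (Rat.num_dvd a (by positivity)))
  have hden : ((a : ℚ) / 2 ^ T).den ≤ 2 ^ T := by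
    rw [hN]
    have := Int.le_of_dvd (by positivity) (Rat.den_dvd a (2 ^ T))
    rw [Rat.divInt_eq_div] at this
    exact_mod_cast this
  have h1 : ((a : ℚ) / 2 ^ T).num.natAbs.size ≤ T + s := Nat.size_le.2 (hnum.trans_lt ha)
  have h2 : ((a : ℚ) / 2 ^ T).den.size ≤ T + 1 :=
    Nat.size_le.2 (hden.trans_lt (Nat.pow_lt_pow_right (by norm_num) (Nat.lt_succ_self T)))
  unfold ratLength
  omega

/-- A system of `m` integer inequalities, divided by `2 ^ T`, has short encoding. -/
theorem exists_ratPolyhedron_of_int_system {R : Type*} [Fintype R] {m n r : ℕ}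
    (hm : Fintype.card R = m) (A : R → Fin n ⊕ Fin r → ℤ) (D : R → ℤ) (T s : ℕ)
    (hA : ∀ k j, (A k j).natAbs < 2 ^ (T + s)) (hD : ∀ k, (D k).natAbs < 2 ^ (T + s)) :
    ∃ (B : Matrix (Fin m) (Fin n) ℚ) (C : Matrix (Fin m) (Fin r) ℚ) (d : Fin m → ℚ),
      matLength B + matLength C + vecLength d ≤ m * (n + r + 1) * (2 * T + s + 3) ∧
      ∀ x y, (x, y) ∈ ratPolyhedron B C d ↔
        ∀ k, ∑ j, (A k j : ℝ) * Sum.elim (fun i => x i) (fun i => y i) j ≤ D k := by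
  subst hm
  let e := (Fintype.equivFin R).symm
  refine ⟨fun i j => (A (e i) (.inl j) : ℚ) / 2 ^ T, fun i j => (A (e i) (.inr j) : ℚ) / 2 ^ T,
    fun i => (D (e i) : ℚ) / 2 ^ T, ?_, fun x y => ?_⟩
  · have hB : matLength (fun i j => (A (e i) (.inl j) : ℚ) / 2 ^ T) ≤
        Fintype.card R * n + Fintype.card R * (n * (2 * T + s + 2)) := by
      refine Nat.add_le_add_left ((Finset.sum_le_card_nsmul _ _ (n * (2 * T + s + 2))
        fun i _ => ?_).trans (by simp)) _
      exact (Finset.sum_le_card_nsmul _ _ (2 * T + s + 2) fun j _ =>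
        ratLength_intCast_div_two_pow_le (hA _ _)).trans (by simp)
    have hC : matLength (fun i j => (A (e i) (.inr j) : ℚ) / 2 ^ T) ≤
        Fintype.card R * r + Fintype.card R * (r * (2 * T + s + 2)) := by
      refine Nat.add_le_add_left ((Finset.sum_le_card_nsmul _ _ (r * (2 * T + s + 2))
        fun i _ => ?_).trans (by simp)) _
      exact (Finset.sum_le_card_nsmul _ _ (2 * T + s + 2) fun j _ =>
        ratLength_intCast_div_two_pow_le (hA _ _)).trans (by simp)
    have hd : vecLength (fun i => (D (e i) : ℚ) / 2 ^ T) ≤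
        Fintype.card R + Fintype.card R * (2 * T + s + 2) := by
      refine Nat.add_le_add_left ((Finset.sum_le_card_nsmul _ _ (2 * T + s + 2) fun i _ => ?_).trans
        (by simp)) _
      exact ratLength_intCast_div_two_pow_le (hD _)
    refine (Nat.add_le_add (Nat.add_le_add hB hC) hd).trans (le_of_eq ?_)
    ring
  · rw [← e.forall_congr_right]
    refine forall_congr' fun i => ?_
    have hT : (0 : ℝ) < 2 ^ T := by positivity
    push_cast
    simp only [Fintype.sum_sum_type, Sum.elim_inl, Sum.elim_inr, div_mul_eq_mul_div]
    rw [← Finset.sum_div, ← Finset.sum_div, ← add_div, div_le_div_iff_of_pos_right hT]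

/-! ### Lifting to the affine span of normalized slacks -/

/-- The orthogonal projection along a subspace `W`, as a matrix with entries in `[-1, 1]`. -/
theorem exists_matrix_orthogonal_projection {ι : Type*} [Fintype ι]
    (W : Submodule ℝ (EuclideanSpace ℝ ι)) :
    ∃ M : ι → ι → ℝ, (∀ i j, |M i j| ≤ 1) ∧ (∀ v ∈ W, ∀ i, ∑ j, M i j * v j = 0) ∧
      ∀ v : EuclideanSpace ℝ ι, v - WithLp.toLp 2 (fun i => ∑ j, M i j * v j) ∈ W := by
  classical
  have key : ∀ (v : EuclideanSpace ℝ ι) i,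
      ∑ j, (Wᗮ.starProjection (EuclideanSpace.single j 1)) i * v j = Wᗮ.starProjection v i := by
    intro v i
    have hv : v = ∑ j, v j • EuclideanSpace.single j (1 : ℝ) := by
      ext k; simp [Finset.sum_apply, Pi.single_apply]
    generalize Wᗮ.starProjection = f
    conv_rhs => rw [hv]
    simp [mul_comm]
  refine ⟨fun i j => (Wᗮ.starProjection (EuclideanSpace.single j 1)) i, fun i j => ?_,
    fun v hv i => ?_, fun v => ?_⟩
  · refine (PiLp.norm_apply_le (Wᗮ.starProjection (EuclideanSpace.single j (1 : ℝ))) i).trans ?_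
    refine (Submodule.norm_starProjection_apply_le _ _).trans ?_
    simp
  · rw [key, (Submodule.starProjection_apply_eq_zero_iff _).2
      (Submodule.le_orthogonal_orthogonal W hv)]
    rfl
  · simp only [key]
    change v - Wᗮ.starProjection v ∈ W
    rw [Submodule.starProjection_orthogonal_val, sub_sub_cancel]
    exact Submodule.starProjection_apply_mem _ _

/-- An extended formulation of `conv X` restricts to the affine span of finitely many points of a
unit cube, the slack coordinates being scaled so that each attains the value `1` or vanishes. -/
theorem exists_normalized_lift {n r : ℕ} {P X : Set (EuclideanSpace ℝ (Fin n))}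
    (hX : ∀ x ∈ X, ∀ i, x i = 0 ∨ x i = 1) (hfin : X.Finite) (hne : X.Nonempty) (hXP : X ⊆ P)
    (h : HasExtendedFormulation P r) :
    ∃ Z : Set (EuclideanSpace ℝ (Fin n ⊕ Fin r)), Z.Nonempty ∧
      (∀ z ∈ Z, ∀ k, 0 ≤ z k ∧ z k ≤ 1) ∧
      (∀ j, (∃ z ∈ Z, z (.inr j) = 1) ∨ ∀ z ∈ Z, z (.inr j) = 0) ∧
      (∀ x ∈ X, ∃ z ∈ Z, ∀ i, z (.inl i) = x i) ∧
      ∀ m ∈ affineSpan ℝ Z, (∀ j, 0 ≤ m (.inr j)) → WithLp.toLp 2 (fun i => m (.inl i)) ∈ P := by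
  obtain ⟨m, q, p, C, c, D, d, rfl⟩ := h
  have hw : ∀ x, ∃ w, x ∈ X → (∀ i, C.mulVec w i ≤ c i) ∧ D.mulVec w = d ∧ p w = x := by
    intro x
    by_cases hx : x ∈ X
    · obtain ⟨w, ⟨h1, h2⟩, h3⟩ := hXP hx
      exact ⟨w, fun _ => ⟨h1, h2, h3⟩⟩
    · exact ⟨0, fun h => absurd h hx⟩
  choose w hw using hw
  have hl : ∀ j, ∃ l : ℝ, 0 < l ∧ (∀ x ∈ X, c j - C.mulVec (w x) j ≤ l) ∧
      ((∃ x ∈ X, c j - C.mulVec (w x) j = l) ∨ ∀ x ∈ X, c j - C.mulVec (w x) j = 0) := by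
    intro j
    obtain ⟨x₀, hx₀, hmax⟩ := X.exists_max_image (fun x => c j - C.mulVec (w x) j) hfin hne
    -- The scale is the largest slack over `X`; if that is 0, any positive scale serves.
    rcases (sub_nonneg.2 ((hw x₀ hx₀).1 j)).lt_or_eq with hpos | h0
    · exact ⟨_, hpos, hmax, .inl ⟨x₀, hx₀, rfl⟩⟩
    · have h' : ∀ x ∈ X, c j - C.mulVec (w x) j = 0 := fun x hx =>
        le_antisymm ((hmax x hx).trans h0.symm.le) (sub_nonneg.2 ((hw x hx).1 j))
      exact ⟨1, one_pos, fun x hx => (h' x hx).le.trans zero_le_one, .inr h'⟩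
  choose l hl0 hlmax hl1 using hl
  refine ⟨(fun x => WithLp.toLp 2
    (Sum.elim (fun i => x i) fun j => (c j - C.mulVec (w x) j) / l j)) '' X,
    hne.image _, ?_, ?_, ?_, ?_⟩
  · rintro _ ⟨x, hx, rfl⟩ (i | j)
    · rcases hX x hx i with h | h <;> simp [h]
    · simp only [Sum.elim_inr]
      exact ⟨div_nonneg (sub_nonneg.2 ((hw x hx).1 j)) (hl0 j).le,
        (div_le_one (hl0 j)).2 (hlmax j x hx)⟩
  · intro j
    rcases hl1 j with ⟨x, hx, h⟩ | h
    · exact .inl ⟨_, ⟨x, hx, rfl⟩, by simp [h, (hl0 j).ne']⟩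
    · refine .inr ?_
      rintro _ ⟨x, hx, rfl⟩
      simp [h x hx]
  · exact fun x hx => ⟨_, ⟨x, hx, rfl⟩, fun i => rfl⟩
  · intro z hz hz0
    -- These conditions are affine in `(z, v)`, so they extend from `Z` to its affine span;
    -- nonnegative slacks then make `v` feasible.
    have key : ∃ v, D.mulVec v = d ∧ (∀ i, z (.inl i) = p v i) ∧
        ∀ j, z (.inr j) * l j = c j - C.mulVec v j := by
      refine affineSpan_induction (p := fun z : EuclideanSpace ℝ (Fin n ⊕ Fin r) =>
        ∃ v, D.mulVec v = d ∧ (∀ i, z (.inl i) = p v i) ∧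
          ∀ j, z (.inr j) * l j = c j - C.mulVec v j) hz ?_ ?_
      · rintro _ ⟨x, hx, rfl⟩
        refine ⟨w x, (hw x hx).2.1, fun i => ?_, fun j => ?_⟩
        · simp [(hw x hx).2.2]
        · simp [(hl0 j).ne']
      · rintro a z₁ z₂ z₃ ⟨v₁, d₁, p₁, c₁⟩ ⟨v₂, d₂, p₂, c₂⟩ ⟨v₃, d₃, p₃, c₃⟩
        refine ⟨a • (v₁ - v₂) + v₃, ?_, fun i => ?_, fun j => ?_⟩
        · simp [Matrix.mulVec_add, Matrix.mulVec_smul, Matrix.mulVec_sub, d₁, d₂, d₃]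
        · simp [p₁, p₂, p₃]
        · simp only [vsub_eq_sub, vadd_eq_add, PiLp.add_apply, PiLp.smul_apply, PiLp.sub_apply,
            Matrix.mulVec_add, Matrix.mulVec_smul, Matrix.mulVec_sub, Pi.add_apply, Pi.smul_apply,
            Pi.sub_apply, smul_eq_mul]
          linear_combination a * c₁ j - a * c₂ j + c₃ j
    obtain ⟨v, hv, hp, hc⟩ := key
    refine ⟨v, ⟨fun j => ?_, hv⟩, ?_⟩
    · have := mul_nonneg (hz0 j) (hl0 j).le
      rw [hc j] at this
      linarith
    · ext i
      simp [hp]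

/-- A point with nonnegative slacks close to the affine span of a normalized lift of `P` is close
to `P`: averaging with points whose slacks are `1` restores nonnegativity. -/
theorem exists_mem_near_of_near_affineSpan {n r : ℕ} {P : Set (EuclideanSpace ℝ (Fin n))}
    {Z : Set (EuclideanSpace ℝ (Fin n ⊕ Fin r))} (hne : Z.Nonempty)
    (hZ : ∀ z ∈ Z, ∀ k, 0 ≤ z k ∧ z k ≤ 1)
    (hZ1 : ∀ j, (∃ z ∈ Z, z (.inr j) = 1) ∨ ∀ z ∈ Z, z (.inr j) = 0)
    (hP : ∀ x ∈ P, ∀ i, 0 ≤ x i ∧ x i ≤ 1)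
    (hZP : ∀ m ∈ affineSpan ℝ Z, (∀ j, 0 ≤ m (.inr j)) →
      WithLp.toLp 2 (fun i => m (.inl i)) ∈ P)
    {m z : EuclideanSpace ℝ (Fin n ⊕ Fin r)} (hm : m ∈ affineSpan ℝ Z) {τ : ℝ} (hτ0 : 0 ≤ τ)
    (hτ : ∀ k, |z k - m k| ≤ τ) (hz : ∀ j, 0 ≤ z (.inr j)) :
    ∃ x ∈ P, ∀ i, |z (.inl i) - x i| ≤ τ * (1 + r) := by
  have hg : ∀ j, ∃ g ∈ Z, g (.inr j) = 1 ∨ ∀ z ∈ Z, z (.inr j) = 0 := fun j =>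
    (hZ1 j).elim (fun ⟨g, hg, h⟩ => ⟨g, hg, .inl h⟩) fun h => ⟨_, hne.some_mem, .inr h⟩
  choose g hgZ hg using hg
  have hpos : 0 < 1 + r * τ := by positivity
  -- `m'` is the weighted mean of `m` (weight 1) and the `g j` (weight `τ` each): slacks of `m` are
  -- at least `-τ`, and `τ * g j` compensates slack `j`.
  obtain ⟨m', hm', hmm⟩ : ∃ m' ∈ affineSpan ℝ Z,
      ∀ k, (1 + r * τ) * m' k = m k + τ * ∑ j, g j k := by
    refine ⟨(∑ j, (τ / (1 + r * τ)) • (g j -ᵥ m)) +ᵥ m,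
      AffineSubspace.vadd_mem_of_mem_direction (Submodule.sum_mem _ fun j _ =>
        Submodule.smul_mem _ _ (AffineSubspace.vsub_mem_direction
          (subset_affineSpan ℝ Z (hgZ j)) hm)) hm, fun k => ?_⟩
    have : ((∑ j, (τ / (1 + r * τ)) • (g j -ᵥ m)) +ᵥ m) k =
        τ / (1 + r * τ) * (∑ j, g j k - r * m k) + m k := by
      simp [← Finset.mul_sum, Finset.sum_sub_distrib]
    rw [this]
    field_simp
    ring
  have hm0 : ∀ j, 0 ≤ m' (.inr j) := by
    intro j
    refine nonneg_of_mul_nonneg_right ?_ hpos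
    rw [hmm]
    have hsum : g j (.inr j) ≤ ∑ j', g j' (.inr j) :=
      Finset.single_le_sum (f := fun j' => g j' (.inr j)) (fun j' _ => (hZ _ (hgZ j') _).1)
        (Finset.mem_univ j)
    rcases hg j with h | h
    · have h1 := (abs_le.1 (hτ (.inr j))).2
      have h2 := hz j
      rw [h] at hsum
      nlinarith
    · have : m (.inr j) = 0 := by
        refine affineSpan_induction
          (p := fun z : EuclideanSpace ℝ (Fin n ⊕ Fin r) => z (.inr j) = 0) hm h ?_
        intro a u v w hu hv hw
        simp [hu, hv, hw]
      rw [this, zero_add]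
      exact mul_nonneg hτ0 ((hZ _ (hgZ j) _).1.trans hsum)
  refine ⟨_, hZP m' hm' hm0, fun i => ?_⟩
  have hb := hP _ (hZP m' hm' hm0) i
  simp only at hb ⊢
  -- Expressed through `m'`, not `m`: as `m'` projects into `P`, its coordinates lie in `[0, 1]`,
  -- whatever the size of `m`.
  have h1 : m (.inl i) - m' (.inl i) = τ * ∑ j, (m' (.inl i) - g j (.inl i)) := by
    have := hmm (.inl i)
    simp only [Finset.sum_sub_distrib, Finset.sum_const, Finset.card_univ, Fintype.card_fin,
      nsmul_eq_mul]
    linear_combination -this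
  have h2 : |m (.inl i) - m' (.inl i)| ≤ τ * r := by
    rw [h1, abs_mul, abs_of_nonneg hτ0]
    refine mul_le_mul_of_nonneg_left ((Finset.abs_sum_le_sum_abs _ _).trans ?_) hτ0
    refine (Finset.sum_le_card_nsmul _ _ 1 fun j _ => ?_).trans (by simp)
    have := hZ _ (hgZ j) (.inl i)
    rw [abs_le]
    constructor <;> linarith
  have h3 := abs_add_le (z (.inl i) - m (.inl i)) (m (.inl i) - m' (.inl i))
  rw [sub_add_sub_cancel] at h3
  have h4 := hτ (.inl i)
  linarith

/-! ### Rounding the equations -/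

/-- Two-sided integer inequalities and box constraints on the last `r` variables, written as one
system of one-sided integer inequalities. -/
theorem exists_int_system {n r T s : ℕ} (F : Fin n ⊕ Fin r → Fin n ⊕ Fin r → ℤ)
    (G : Fin n ⊕ Fin r → ℤ) (b : ℕ) (hs : 0 < s) (hF : ∀ i j, (F i j).natAbs < 2 ^ (T + s))
    (hG : ∀ i, (G i).natAbs + b < 2 ^ (T + s)) :
    ∃ (A : (Fin n ⊕ Fin r) × Bool ⊕ Fin r × Bool → Fin n ⊕ Fin r → ℤ)
      (D : (Fin n ⊕ Fin r) × Bool ⊕ Fin r × Bool → ℤ),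
      (∀ k j, (A k j).natAbs < 2 ^ (T + s)) ∧ (∀ k, (D k).natAbs < 2 ^ (T + s)) ∧
      ∀ z : Fin n ⊕ Fin r → ℝ, (∀ k, ∑ j, (A k j : ℝ) * z j ≤ D k) ↔
        (∀ i, |∑ j, (F i j : ℝ) * z j - G i| ≤ b) ∧ ∀ j, 0 ≤ z (.inr j) ∧ z (.inr j) ≤ 1 := by
  have hlt : (2 : ℕ) ^ T < 2 ^ (T + s) := Nat.pow_lt_pow_right (by norm_num) (by omega)
  have hN : (0 : ℝ) < 2 ^ T := by positivity
  have hsingle : ∀ i j : Fin n ⊕ Fin r,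
      (Pi.single (M := fun _ => ℤ) i (2 ^ T) j).natAbs < 2 ^ (T + s) := by
    intro i j
    rcases eq_or_ne j i with rfl | h
    · simpa [Int.natAbs_pow] using hlt
    · simp [h]
  have hsum : ∀ (i : Fin n ⊕ Fin r) (z : Fin n ⊕ Fin r → ℝ),
      ∑ j, ((Pi.single (M := fun _ => ℤ) i (2 ^ T) j : ℤ) : ℝ) * z j = 2 ^ T * z i := by
    intro i z
    rw [Finset.sum_eq_single i (fun j _ h => by simp [h]) (by simp)]
    simp
  refine ⟨Sum.elim (fun k j => bif k.2 then F k.1 j else -F k.1 j)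
    (fun k j => bif k.2 then Pi.single (M := fun _ => ℤ) (.inr k.1) (2 ^ T) j
      else -Pi.single (M := fun _ => ℤ) (.inr k.1) (2 ^ T) j),
    Sum.elim (fun k => bif k.2 then G k.1 + b else -G k.1 + b)
      (fun k => bif k.2 then 2 ^ T else 0), ?_, ?_, fun z => ?_⟩
  · rintro (⟨i, _ | _⟩ | ⟨i, _ | _⟩) j
    · simpa using hF i j
    · simpa using hF i j
    · simpa using hsingle (.inr i) j
    · simpa using hsingle (.inr i) j
  · rintro (⟨i, _ | _⟩ | ⟨i, _ | _⟩)
    · have := hG i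
      simp only [Sum.elim_inl, cond_false]
      omega
    · have := hG i
      simp only [Sum.elim_inl, cond_true]
      omega
    · simp
    · simpa [Int.natAbs_pow] using hlt
  · simp only [Sum.forall, Prod.forall, Bool.forall_bool, Sum.elim_inl, Sum.elim_inr, cond_true,
      cond_false, Int.cast_neg, neg_mul, Finset.sum_neg_distrib, hsum]
    push_cast
    have h1 : ∀ i, |∑ j, (F i j : ℝ) * z j - G i| ≤ b ↔
        -∑ j, (F i j : ℝ) * z j ≤ -G i + b ∧ ∑ j, (F i j : ℝ) * z j ≤ G i + b := by
      intro i
      rw [abs_le]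
      constructor <;> rintro ⟨h, h'⟩ <;> constructor <;> linarith
    have h2 : ∀ j, (0 ≤ z (.inr j) ∧ z (.inr j) ≤ 1) ↔
        -(2 ^ T * z (.inr j)) ≤ 0 ∧ 2 ^ T * z (.inr j) ≤ 2 ^ T := by
      intro j
      rw [neg_nonpos, mul_nonneg_iff_of_pos_left hN, mul_le_iff_le_one_right hN]
    simp only [h1, h2]

/-- Rounding the orthogonal projection that cuts out the affine span of a normalized lift. -/
theorem exists_rounded_equations {n r : ℕ} {P : Set (EuclideanSpace ℝ (Fin n))}
    {Z : Set (EuclideanSpace ℝ (Fin n ⊕ Fin r))} (hne : Z.Nonempty)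
    (hZ : ∀ z ∈ Z, ∀ k, 0 ≤ z k ∧ z k ≤ 1)
    (hZ1 : ∀ j, (∃ z ∈ Z, z (.inr j) = 1) ∨ ∀ z ∈ Z, z (.inr j) = 0)
    (hP : ∀ x ∈ P, ∀ i, 0 ≤ x i ∧ x i ≤ 1)
    (hZP : ∀ m ∈ affineSpan ℝ Z, (∀ j, 0 ≤ m (.inr j)) →
      WithLp.toLp 2 (fun i => m (.inl i)) ∈ P)
    {N : ℝ} (hN0 : 0 < N) (hN : 2 * n * (1 + r) ≤ N) :
    ∃ (F : Fin n ⊕ Fin r → Fin n ⊕ Fin r → ℤ) (G : Fin n ⊕ Fin r → ℤ),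
      (∀ i j, |(F i j : ℝ)| ≤ N + 1) ∧ (∀ i, |(G i : ℝ)| ≤ (n + r) * N + 1) ∧
      (∀ z ∈ Z, ∀ i, |∑ j, (F i j : ℝ) * z j - G i| ≤ n + r + 1) ∧
      ∀ z : EuclideanSpace ℝ (Fin n ⊕ Fin r),
        (∀ i, |∑ j, (F i j : ℝ) * z j - G i| ≤ n + r + 1) →
        (∀ j, 0 ≤ z (.inr j) ∧ z (.inr j) ≤ 1) →
        ∃ x ∈ P, ∀ i, |z (.inl i) - x i| ≤ 4 * (n + r + 1) * (1 + r) / N := by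
  obtain ⟨M, hM1, hMW, hMsub⟩ := exists_matrix_orthogonal_projection (affineSpan ℝ Z).direction
  obtain ⟨z₀, hz₀⟩ := hne
  have hz₀' := subset_affineSpan ℝ Z hz₀
  have hfl : ∀ t : ℝ, |(⌊t⌋ : ℝ) - t| ≤ 1 := fun t => by
    rw [abs_le]
    constructor <;> linarith [Int.floor_le t, Int.lt_floor_add_one t]
  have hβ : ∀ i, |∑ j, M i j * z₀ j| ≤ n + r := by
    intro i
    refine (Finset.abs_sum_le_sum_abs _ _).trans
      ((Finset.sum_le_card_nsmul _ _ 1 fun j _ => ?_).trans (by simp))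
    rw [abs_mul, abs_of_nonneg (hZ z₀ hz₀ j).1]
    exact mul_le_one₀ (hM1 i j) (hZ z₀ hz₀ j).1 (hZ z₀ hz₀ j).2
  have hround : ∀ (z : EuclideanSpace ℝ (Fin n ⊕ Fin r)) i,
      |(∑ j, (⌊M i j * N⌋ : ℝ) * z j - ⌊(∑ j, M i j * z₀ j) * N⌋) -
        (∑ j, M i j * z j - ∑ j, M i j * z₀ j) * N| ≤ ∑ j, |z j| + 1 := by
    intro z i
    have h1 : (∑ j, (⌊M i j * N⌋ : ℝ) * z j - ⌊(∑ j, M i j * z₀ j) * N⌋) -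
        (∑ j, M i j * z j - ∑ j, M i j * z₀ j) * N =
        ∑ j, ((⌊M i j * N⌋ : ℝ) - M i j * N) * z j -
          (⌊(∑ j, M i j * z₀ j) * N⌋ - (∑ j, M i j * z₀ j) * N) := by
      have : ∑ j, ((⌊M i j * N⌋ : ℝ) - M i j * N) * z j =
          ∑ j, (⌊M i j * N⌋ : ℝ) * z j - (∑ j, M i j * z j) * N := by
        rw [Finset.sum_mul, ← Finset.sum_sub_distrib]
        exact Finset.sum_congr rfl fun j _ => by ring
      rw [this]
      ring
    rw [h1]
    refine (abs_sub _ _).trans (add_le_add ((Finset.abs_sum_le_sum_abs _ _).trans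
      (Finset.sum_le_sum fun j _ => ?_)) (hfl _))
    rw [abs_mul]
    exact mul_le_of_le_one_left (abs_nonneg _) (hfl _)
  refine ⟨fun i j => ⌊M i j * N⌋, fun i => ⌊(∑ j, M i j * z₀ j) * N⌋, fun i j => ?_, fun i => ?_,
    fun z hz i => ?_, fun z hz hz01 => ?_⟩
  · have h1 := abs_add_le ((⌊M i j * N⌋ : ℝ) - M i j * N) (M i j * N)
    rw [sub_add_cancel] at h1
    have h2 : |M i j * N| ≤ N := by
      rw [abs_mul, abs_of_pos hN0]
      exact mul_le_of_le_one_left hN0.le (hM1 i j)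
    linarith [hfl (M i j * N)]
  · have h1 := abs_add_le ((⌊(∑ j, M i j * z₀ j) * N⌋ : ℝ) - (∑ j, M i j * z₀ j) * N)
      ((∑ j, M i j * z₀ j) * N)
    rw [sub_add_cancel] at h1
    have h2 : |(∑ j, M i j * z₀ j) * N| ≤ (n + r) * N := by
      rw [abs_mul, abs_of_pos hN0]
      exact mul_le_mul_of_nonneg_right (hβ i) hN0.le
    linarith [hfl ((∑ j, M i j * z₀ j) * N)]
  · have h0 : ∑ j, M i j * z j - ∑ j, M i j * z₀ j = 0 := by
      rw [← Finset.sum_sub_distrib, ← hMW _ (AffineSubspace.vsub_mem_direction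
        (subset_affineSpan ℝ Z hz) hz₀') i]
      exact Finset.sum_congr rfl fun j _ => by simp [mul_sub]
    have h1 := hround z i
    rw [h0, zero_mul, sub_zero] at h1
    refine h1.trans (add_le_add_left ?_ 1)
    refine (Finset.sum_le_card_nsmul _ _ 1 fun j _ => ?_).trans (by simp)
    rw [abs_of_nonneg (hZ z hz j).1]
    exact (hZ z hz j).2
  -- The rounding error grows with `S`, which has no a priori bound since `x` is not boxed; `τ`
  -- therefore depends on `S`.
  · set S := ∑ j, |z j| with hS
    have hS0 : 0 ≤ S := Finset.sum_nonneg fun _ _ => abs_nonneg _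
    set τ := (n + r + 1 + (S + 1)) / N with hτ
    have hτ0 : 0 ≤ τ := by positivity
    have hNτ : N * τ = n + r + 1 + (S + 1) := by rw [hτ]; field_simp
    have hnear : ∀ i, |∑ j, M i j * (z - z₀) j| ≤ τ := by
      intro i
      have h1 := abs_sub_abs_le_abs_sub ((∑ j, M i j * z j - ∑ j, M i j * z₀ j) * N)
        (∑ j, (⌊M i j * N⌋ : ℝ) * z j - ⌊(∑ j, M i j * z₀ j) * N⌋)
      rw [abs_sub_comm ((∑ j, M i j * z j - ∑ j, M i j * z₀ j) * N), abs_mul, abs_of_pos hN0] at h1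
      have h2 : ∑ j, M i j * (z - z₀) j = ∑ j, M i j * z j - ∑ j, M i j * z₀ j := by
        rw [← Finset.sum_sub_distrib]
        exact Finset.sum_congr rfl fun j _ => by simp [mul_sub]
      rw [h2, hτ, le_div_iff₀ hN0]
      linarith [hround z i, hz i]
    have hm : z - WithLp.toLp 2 (fun i => ∑ j, M i j * (z - z₀) j) ∈ affineSpan ℝ Z := by
      have := AffineSubspace.vadd_mem_of_mem_direction (hMsub (z - z₀)) hz₀'
      rwa [vadd_eq_add, sub_right_comm, sub_add_cancel] at this
    obtain ⟨x, hxP, hx⟩ := exists_mem_near_of_near_affineSpan ⟨z₀, hz₀⟩ hZ hZ1 hP hZP hm hτ0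
      (fun k => by simpa using hnear k) fun j => (hz01 j).1
    -- Bootstrap: closeness to `P`, inside the unit cube, bounds `S` in terms of `τ`. As `N ≥ 2 n (1
    -- + r)`, the `τ` term is at most `N τ / 2` and is absorbed, giving `N τ ≤ 4 (n + r + 1)`.
    have hSle : S ≤ n * (1 + τ * (1 + r)) + r := by
      rw [hS, Fintype.sum_sum_type]
      refine add_le_add
        ((Finset.sum_le_card_nsmul _ _ (1 + τ * (1 + r)) fun i _ => ?_).trans
          (by simp [mul_add]))
        ((Finset.sum_le_card_nsmul _ _ 1 fun j _ => ?_).trans (by simp))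
      · have h1 := abs_le.1 (hx i)
        have h2 := hP x hxP i
        rw [abs_le]
        constructor <;> linarith
      · rw [abs_of_nonneg (hz01 j).1]
        exact (hz01 j).2
    refine ⟨x, hxP, fun i => (hx i).trans ?_⟩
    rw [mul_div_right_comm]
    refine mul_le_mul_of_nonneg_right ?_ (by positivity)
    rw [le_div_iff₀ hN0]
    have := mul_le_mul_of_nonneg_right hN hτ0
    linarith

/-! ### Convexity, compactness and linear maxima -/

theorem norm_le_card_mul {n : ℕ} {v : EuclideanSpace ℝ (Fin n)} {b : ℝ} (h : ∀ i, |v i| ≤ b) :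
    ‖v‖ ≤ n * b := by
  have hv : v = ∑ i, v i • EuclideanSpace.single i (1 : ℝ) := by
    ext k; simp [Finset.sum_apply, Pi.single_apply]
  rw [hv]
  refine (norm_sum_le _ _).trans ((Finset.sum_le_card_nsmul _ _ b fun i _ => ?_).trans (by simp))
  simpa [norm_smul] using h i

theorem convex_projX_ratPolyhedron {m n r : ℕ} (B : Matrix (Fin m) (Fin n) ℚ)
    (C : Matrix (Fin m) (Fin r) ℚ) (d : Fin m → ℚ) : Convex ℝ (projX (ratPolyhedron B C d)) := by
  rintro x ⟨y, hy⟩ x' ⟨y', hy'⟩ a b ha hb hab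
  refine ⟨a • y + b • y', fun i => ?_⟩
  have h1 := mul_le_mul_of_nonneg_left (hy i) ha
  have h2 := mul_le_mul_of_nonneg_left (hy' i) hb
  have h3 : (d i : ℝ) = a * d i + b * d i := by rw [← add_mul, hab, one_mul]
  rw [h3]
  refine le_trans (le_of_eq ?_) (add_le_add h1 h2)
  simp only [PiLp.add_apply, PiLp.smul_apply, smul_eq_mul, mul_add, Finset.sum_add_distrib,
    Finset.mul_sum, mul_left_comm]
  ring

theorem isClosed_ratPolyhedron {m n r : ℕ} (B : Matrix (Fin m) (Fin n) ℚ)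
    (C : Matrix (Fin m) (Fin r) ℚ) (d : Fin m → ℚ) : IsClosed (ratPolyhedron B C d) := by
  simp only [ratPolyhedron, Set.ofPred_forall]
  exact isClosed_iInter fun i => isClosed_le (by fun_prop) continuous_const

theorem finite_of_zero_one {n : ℕ} {X : Set (EuclideanSpace ℝ (Fin n))}
    (hX : ∀ x ∈ X, ∀ i, x i = 0 ∨ x i = 1) : X.Finite := by
  have h : (Set.univ.pi fun _ : Fin n => ({0, 1} : Set ℝ)).Finite :=
    Set.Finite.pi fun _ => Set.toFinite _
  refine (h.image (WithLp.toLp 2)).subset fun x hx => ⟨x, fun i _ => ?_, rfl⟩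
  simpa using hX x hx i

theorem coord_mem_of_mem_convexHull {n : ℕ} {X : Set (EuclideanSpace ℝ (Fin n))}
    (hX : ∀ x ∈ X, ∀ i, x i = 0 ∨ x i = 1) {x : EuclideanSpace ℝ (Fin n)}
    (hx : x ∈ convexHull ℝ X) (i : Fin n) : 0 ≤ x i ∧ x i ≤ 1 := by
  have hc : Convex ℝ {x : EuclideanSpace ℝ (Fin n) | 0 ≤ x i ∧ x i ≤ 1} := by
    intro u hu v hv a b ha hb hab
    exact convex_Icc (0 : ℝ) 1 hu hv ha hb hab
  exact convexHull_min (fun u hu => by rcases hX u hu i with h | h <;> simp [h]) hc hx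

/-- Comparison of linear maxima over a compact set and over a set in its `ε`-neighbourhood. -/
theorem exists_isGreatest_sub_le {n : ℕ} {P R : Set (EuclideanSpace ℝ (Fin n))} {ε : ℝ}
    (hP : IsCompact P) (hR : IsCompact R) (hne : P.Nonempty) (hPR : P ⊆ R) (hRP : R ⊆ fatten P ε)
    (c : EuclideanSpace ℝ (Fin n)) : ∃ MR MP : ℝ,
      IsGreatest ((fun x => inner ℝ c x) '' R) MR ∧ IsGreatest ((fun x => inner ℝ c x) '' P) MP ∧
      MR - MP ≤ ε * ‖c‖ := by
  have hcont : Continuous fun x : EuclideanSpace ℝ (Fin n) => inner ℝ c x := by fun_prop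
  obtain ⟨MR, hMR⟩ := (hR.image hcont).exists_isGreatest ((hne.mono hPR).image _)
  obtain ⟨MP, hMP⟩ := (hP.image hcont).exists_isGreatest (hne.image _)
  refine ⟨MR, MP, hMR, hMP, ?_⟩
  obtain ⟨w, hw, rfl⟩ := hMR.1
  obtain ⟨x, hx, z, hz, rfl⟩ := hRP hw
  have h1 : inner ℝ c x ≤ MP := hMP.2 ⟨x, hx, rfl⟩
  have h2 := real_inner_le_norm c z
  have h3 := mul_le_mul_of_nonneg_left hz (norm_nonneg c)
  simp only [inner_add_right]
  linarith [mul_comm ε ‖c‖]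

/-! ### Choice of precision and assembly -/

/-- A precision `2 ^ L` of logarithmic size. -/
theorem exists_two_pow_mul_ge_one {ε : ℝ} (hε : 0 < ε) :
    ∃ L : ℕ, 1 ≤ 2 ^ L * ε ∧ (L : ℝ) ≤ 2 * max 0 (Real.log (1 / ε)) + 1 := by
  set l := max 0 (Real.log (1 / ε)) with hl
  have hl0 : 0 ≤ l := le_max_left _ _
  -- The factor 2 suffices because `log 2 > 1 / 2`.
  refine ⟨⌈2 * l⌉₊, ?_, (Nat.ceil_lt_add_one (by positivity)).le⟩
  rw [← div_le_iff₀ hε, ← Real.log_le_log_iff (by positivity) (by positivity), Real.log_pow]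
  refine (le_max_right 0 _).trans ?_
  rw [← hl]
  nlinarith [Nat.le_ceil (2 * l), Real.log_two_gt_d9]

/-- The projection of an extended formulation of size `r` rounded to precision `ε`. -/
theorem exists_rational_extended_formulation {n r : ℕ} {X P : Set (EuclideanSpace ℝ (Fin n))}
    (hX : ∀ x ∈ X, ∀ i, x i = 0 ∨ x i = 1) (hne : X.Nonempty) (hPX : P = convexHull ℝ X)
    (h : HasExtendedFormulation P r) {ε : ℝ} {L : ℕ} (hL : 1 ≤ 2 ^ L * ε) :
    ∃ (B : Matrix (Fin (4 * r + 2 * n)) (Fin n) ℚ) (C : Matrix (Fin (4 * r + 2 * n)) (Fin r) ℚ)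
      (d : Fin (4 * r + 2 * n) → ℚ),
      Bornology.IsBounded (ratPolyhedron B C d) ∧
      matLength B + matLength C + vecLength d ≤
        (4 * r + 2 * n) * (n + r + 1) * (7 * (n + r) + 15 + 2 * L) ∧
      P ⊆ projX (ratPolyhedron B C d) ∧ projX (ratPolyhedron B C d) ⊆ fatten P ε := by
  have hP01 : ∀ x ∈ P, ∀ i, 0 ≤ x i ∧ x i ≤ 1 := by
    rw [hPX]
    exact fun x hx => coord_mem_of_mem_convexHull hX hx
  obtain ⟨Z, hZne, hZ01, hZ1, hXZ, hZP⟩ := exists_normalized_lift hX (finite_of_zero_one hX) hne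
    (hPX ▸ subset_convexHull ℝ X) h
  -- Three factors `2 ^ (n + r)` dominate `n`, `n + r + 1` and `1 + r`; the 5 covers constants and
  -- `L` supplies `ε`.
  set T := 3 * (n + r) + 5 + L with hT
  have hk : (n + r + 1 : ℕ) ≤ 2 ^ (n + r) := Nat.lt_two_pow_self
  have hkR : (n + r + 1 : ℝ) ≤ 2 ^ (n + r) := by exact_mod_cast hk
  have hn0 : (0 : ℝ) ≤ n := n.cast_nonneg
  have hr0 : (0 : ℝ) ≤ r := r.cast_nonneg
  have hT' : (2 : ℝ) ^ T = 32 * 2 ^ (n + r) * 2 ^ (n + r) * 2 ^ (n + r) * 2 ^ L := by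
    rw [hT]; ring
  have hq1 : (1 : ℝ) ≤ 2 ^ (n + r) := one_le_pow₀ (by norm_num)
  have hL1 : (1 : ℝ) ≤ 2 ^ L := one_le_pow₀ (by norm_num)
  have hcube : (n : ℝ) * (4 * (n + r + 1) * (1 + r)) ≤
      32 * 2 ^ (n + r) * 2 ^ (n + r) * 2 ^ (n + r) := by
    calc (n : ℝ) * (4 * (n + r + 1) * (1 + r))
        ≤ 2 ^ (n + r) * (4 * 2 ^ (n + r) * 2 ^ (n + r)) := by gcongr <;> linarith
      _ ≤ 32 * 2 ^ (n + r) * 2 ^ (n + r) * 2 ^ (n + r) := by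
        have : (0 : ℝ) ≤ 2 ^ (n + r) * 2 ^ (n + r) * 2 ^ (n + r) := by positivity
        linarith
  have hN : 2 * n * (1 + r) ≤ (2 : ℝ) ^ T := by
    have h1 : (2 * n * (1 + r) : ℝ) ≤ n * (4 * (n + r + 1) * (1 + r)) := by
      have h0 : (0 : ℝ) ≤ n * (1 + r) := by positivity
      nlinarith
    rw [hT']
    exact (h1.trans hcube).trans (le_mul_of_one_le_right (by positivity) hL1)
  obtain ⟨F, G, hF, hG, hZF, hFP⟩ :=
    exists_rounded_equations hZne hZ01 hZ1 hP01 hZP (N := 2 ^ T) (by positivity) hN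
  have hTk : (n + r + 3 : ℕ) ≤ 2 ^ T := by
    have h1 : 3 ≤ 2 ^ (2 * (n + r) + 5 + L) :=
      le_trans (by norm_num) (Nat.pow_le_pow_right (n := 2) (by norm_num)
        (by omega : 2 ≤ 2 * (n + r) + 5 + L))
    have h2 : 2 ^ T = 2 ^ (n + r) * 2 ^ (2 * (n + r) + 5 + L) := by
      rw [← pow_add, hT]; congr 1; ring
    rw [h2]
    calc n + r + 3 ≤ (n + r + 1) * 3 := by ring_nf; omega
      _ ≤ _ := Nat.mul_le_mul hk h1
  have hF' : ∀ i j, (F i j).natAbs ≤ 2 ^ T + 1 := fun i j => by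
    have := hF i j
    rw [← Int.cast_abs, ← Nat.cast_natAbs] at this
    exact_mod_cast this
  have hG' : ∀ i, (G i).natAbs ≤ (n + r) * 2 ^ T + 1 := fun i => by
    have := hG i
    rw [← Int.cast_abs, ← Nat.cast_natAbs] at this
    exact_mod_cast this
  -- The right-hand sides, of size up to `(n + r) * 2 ^ T` plus the tolerance, determine the extra
  -- `n + r + 2` bits.
  have hpow : (n + r + 2) * 2 ^ T ≤ 2 ^ (T + (n + r + 2)) := by
    rw [pow_add 2 T, mul_comm]
    exact Nat.mul_le_mul_left _ Nat.lt_two_pow_self.le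
  obtain ⟨A, D, hA, hD, hAD⟩ := exists_int_system (T := T) (s := n + r + 2) F G (n + r + 1)
    (by omega) (fun i j => (hF' i j).trans_lt (lt_of_lt_of_le (by nlinarith) hpow))
    (fun i => lt_of_lt_of_le (by have := hG' i; nlinarith) hpow)
  obtain ⟨B, C, d, hlen, hmem⟩ := exists_ratPolyhedron_of_int_system (m := 4 * r + 2 * n)
    (by simp; ring) A D T (n + r + 2) hA hD
  have hsub : projX (ratPolyhedron B C d) ⊆ fatten P ε := by
    rintro x ⟨y, hxy⟩
    obtain ⟨h1, h2⟩ := (hAD _).1 ((hmem x y).1 hxy)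
    obtain ⟨p, hp, hxp⟩ := hFP (WithLp.toLp 2 (Sum.elim (fun i => x i) fun j => y j))
      (fun i => by simpa using h1 i) h2
    refine ⟨p, hp, x - p, (norm_le_card_mul hxp).trans ?_, by abel⟩
    rw [← mul_div_assoc, div_le_iff₀ (by positivity), hT']
    calc _ ≤ _ := hcube
      _ ≤ 32 * 2 ^ (n + r) * 2 ^ (n + r) * 2 ^ (n + r) * (2 ^ L * ε) :=
        le_mul_of_one_le_right (by positivity) hL
      _ = _ := by ring
  refine ⟨B, C, d, ?_, ?_, ?_, hsub⟩
  · have hεP : ∀ x ∈ projX (ratPolyhedron B C d), ‖x‖ ≤ n * 1 + ε := by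
      intro x hx
      obtain ⟨p, hp, z, hz, rfl⟩ := hsub hx
      refine (norm_add_le _ _).trans (add_le_add (norm_le_card_mul fun i => ?_) hz)
      rw [abs_of_nonneg (hP01 p hp i).1]
      exact (hP01 p hp i).2
    refine (Bornology.IsBounded.prod (isBounded_iff_forall_norm_le.2 ⟨_, hεP⟩)
      (isBounded_iff_forall_norm_le.2 ⟨r * 1, ?_⟩)).subset
      (t := projX (ratPolyhedron B C d) ×ˢ {y | ∀ j, 0 ≤ y j ∧ y j ≤ 1}) ?_
    · refine fun y hy => norm_le_card_mul fun j => ?_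
      rw [abs_of_nonneg (hy j).1]
      exact (hy j).2
    · rintro ⟨x, y⟩ hxy
      exact ⟨⟨y, hxy⟩, ((hAD _).1 ((hmem x y).1 hxy)).2⟩
  · refine hlen.trans (Nat.mul_le_mul_left _ ?_)
    omega
  · rw [hPX]
    refine convexHull_min (fun x hx => ?_) (convex_projX_ratPolyhedron B C d)
    obtain ⟨z, hz, hzx⟩ := hXZ x hx
    have hzz : (Sum.elim (fun i => x i) fun j => z (.inr j)) = fun k => z k := by
      funext k
      rcases k with i | j
      · exact (hzx i).symm
      · rfl
    refine ⟨WithLp.toLp 2 fun j => z (.inr j), (hmem _ _).2 ((hAD _).2 ⟨fun i => ?_, fun j => ?_⟩)⟩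
    · simp only [hzz]
      simpa using hZF z hz i
    · exact hZ01 z hz _

theorem mainTheorem4 :
    ∃ p : MvPolynomial (Fin 3) ℝ,
      ∀ (n : ℕ) (X P : Set (EuclideanSpace ℝ (Fin n))),
        (∀ x ∈ X, ∀ i, x i = 0 ∨ x i = 1) → X.Nonempty → P = convexHull ℝ X →
        ∀ ε : ℝ, 0 < ε →
        ∃ (B : Matrix (Fin (4 * xc P + 2 * n)) (Fin n) ℚ)
          (C : Matrix (Fin (4 * xc P + 2 * n)) (Fin (xc P)) ℚ)
          (d : Fin (4 * xc P + 2 * n) → ℚ),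
          Bornology.IsBounded (ratPolyhedron B C d) ∧
          ((matLength B + matLength C + vecLength d : ℕ) : ℝ) ≤
            MvPolynomial.eval ![(n : ℝ), (xc P : ℝ), max 0 (Real.log (1 / ε))] p ∧
          P ⊆ projX (ratPolyhedron B C d) ∧
          projX (ratPolyhedron B C d) ⊆ fatten P ε ∧
          ∀ c : EuclideanSpace ℝ (Fin n), ∃ MQ MP : ℝ,
            IsGreatest ((fun x => inner ℝ c x) '' projX (ratPolyhedron B C d)) MQ ∧
            IsGreatest ((fun x => inner ℝ c x) '' P) MP ∧
            MQ - MP ≤ ε * ‖c‖ := by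
  -- The last factor is `7 (n + r) + 15 + 2 L` with `L ≤ 2 max 0 (log (1 / ε)) + 1`.
  refine ⟨(4 * .X 1 + 2 * .X 0) * (.X 0 + .X 1 + 1) * (7 * (.X 0 + .X 1) + 17 + 4 * .X 2), ?_⟩
  intro n X P hX hne hPX ε hε
  obtain ⟨L, hL, hLle⟩ := exists_two_pow_mul_ge_one hε
  have hxc : HasExtendedFormulation P (xc P) := by
    refine Nat.sInf_mem (s := {k | HasExtendedFormulation P k}) ?_
    rw [hPX]
    exact exists_hasExtendedFormulation (finite_of_zero_one hX)
  obtain ⟨B, C, d, hbdd, hlen, hPQ, hQP⟩ :=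
    exists_rational_extended_formulation hX hne hPX hxc hL
  refine ⟨B, C, d, hbdd, ?_, hPQ, hQP, ?_⟩
  · refine (Nat.cast_le.2 hlen).trans ?_
    have hev : MvPolynomial.eval ![(n : ℝ), (xc P : ℝ), max 0 (Real.log (1 / ε))]
        ((4 * .X 1 + 2 * .X 0) * (.X 0 + .X 1 + 1) * (7 * (.X 0 + .X 1) + 17 + 4 * .X 2)) =
        (4 * xc P + 2 * n) * (n + xc P + 1) *
          (7 * (n + xc P) + 17 + 4 * max 0 (Real.log (1 / ε))) := by
      simp
    rw [hev]
    push_cast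
    refine mul_le_mul_of_nonneg_left ?_ (by positivity)
    linarith
  · have hPc : IsCompact P := hPX ▸ (finite_of_zero_one hX).isCompact_convexHull ℝ
    have hQc : IsCompact (projX (ratPolyhedron B C d)) := by
      have himage : projX (ratPolyhedron B C d) = Prod.fst '' ratPolyhedron B C d :=
        Set.ext fun x => ⟨fun ⟨y, h⟩ => ⟨(x, y), h, rfl⟩, fun ⟨⟨_, y⟩, h, e⟩ => e ▸ ⟨y, h⟩⟩
      rw [himage]
      exact (Metric.isCompact_of_isClosed_isBounded (isClosed_ratPolyhedron B C d) hbdd).image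
        continuous_fst
    exact exists_isGreatest_sub_le hPc hQc (hPX ▸ hne.convexHull) hPQ hQP
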